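/- A solution of the moment problem on a set $I\subseteq\mathbb R$ with data a real sequence $(s_k)_{k\ge 0}$ is a (positive) Borel measure $\rho$ on $\mathbb R$ with $\operatorname{supp}\rho\subseteq I$ such that, for every $k\ge 0$, $\lambda^k$ is $\rho$-integrable and $\int_{\mathbb R}\lambda^k\,d\rho(\lambda)=s_k$. The problem is determinate if it has exactly one solution. The Hamburger problem is the case $I=\mathbb R$; the Stieltjes problem is the case of a half-line, either $I=[0,\infty)$ or $I=(0,\infty)$ (the statement holds for each of the two conventions). Let $I=[0,\infty)$ or $I=(0,\infty)$, and let $(s_k)_{k\ge 0}$ be a real sequence for which the Stieltjes problem on $I$ has a solution. Define $h_{2k}=s_k$ and $h_{2k+1}=0$ for $k\ge 0$, that is, $(h_m)_{m\ge 0}=(s_0,0,s_1,0,s_2,0,\dots)$. Then the Hamburger problem with data $(h_m)$ has a solution, and it is determinate if and only if the Stieltjes problem on $I$ with data $(s_k)$ is determinate. -/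

import Mathlib

open MeasureTheory

/-- `μ` is a Borel measure on the real line with topological support contained in `I`, all of whose
power moments exist and are given by the sequence `s`. -/
structure IsMomentSolutionOn (I : Set ℝ) (s : ℕ → ℝ) (μ : Measure ℝ) : Prop where
  support_subset : μ.support ⊆ I
  integrable_pow : ∀ k : ℕ, Integrable (fun x : ℝ => x ^ k) μ
  moment_eq : ∀ k : ℕ, ∫ x, x ^ k ∂μ = s k

/-- `s` is a moment sequence for `I`: the moment problem on `I` with data `s` has a solution. -/
def IsMomentSequenceOn (I : Set ℝ) (s : ℕ → ℝ) : Prop :=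
  ∃ μ : Measure ℝ, IsMomentSolutionOn I s μ

/-- The moment problem on `I` with data `s` has one and only one solution. -/
def IsDeterminateOn (I : Set ℝ) (s : ℕ → ℝ) : Prop :=
  ∃! μ : Measure ℝ, IsMomentSolutionOn I s μ

/-- The Hamburger moment problem is the one on the whole line. -/
def IsHamburgerMomentSequence (h : ℕ → ℝ) : Prop :=
  IsMomentSequenceOn Set.univ h

/-- Determinacy of the Hamburger moment problem. -/
def IsHamburgerDeterminate (h : ℕ → ℝ) : Prop :=
  IsDeterminateOn Set.univ h

/-- The sequence `s 0, 0, s 1, 0, s 2, 0, …`. -/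
def interlaceZero (s : ℕ → ℝ) (m : ℕ) : ℝ :=
  if Even m then s (m / 2) else 0

/-! Squaring sends every Hamburger solution to a solution on `[0, ∞)`, and symmetrization is a right
inverse of it. This gives existence, and shows that Hamburger determinacy implies Stieltjes
determinacy. The converse must also deal with Hamburger solutions that are not known to be
symmetric.

Suppose `μ` is the only solution on `[δ, ∞)`. The Hahn–Banach extension of the moment functional
that is as large as possible at a given `f` is represented by a measure, which must be `μ`. So `f`
has polynomial majorants on `[δ, ∞)` with almost the same integral (`exists_polynomial_majorant`).
For `f = 1 / (1 + y)` and a majorant `q`, write `(1 + y) q - 1 = A + (y - δ) B` with sums of squares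
`A`, `B`. The value `-1` at `y = -1` bounds `B (-1)` from below. A single square below `B`,
normalized, yields `b` with `b (-1) = 1` and `∫ (y - δ) b² / (1 + y) dμ` small
(`exists_polynomial_eval_neg_one`).

Substituting `y = x²` gives real polynomials `r` with `|r(i)| = 1` and `∫ r² / (1 + x²) dν` small
for all Hamburger solutions `ν`. As `(r(x) - r(i)) / (x - i)` is a polynomial, `1 / (x - i)` is an
`L²` limit of polynomials for the sum of any two solutions. The closure of the polynomials is then
stable under an algebra of bounded continuous functions that separates points, and the two solutions
agree (`eq_of_exists_polynomial`). -/

/-! ### Polynomials nonnegative on a half-line, and sums of squares -/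

open Polynomial in
/-- A real polynomial that is nonnegative on `[δ, ∞)` is of the form `A + (X - δ) B` with `A`
and `B` sums of squares. -/
theorem exists_isSumSq_add_mul_of_nonneg_on_Ici (δ : ℝ) (R : ℝ[X])
    (hR : ∀ y, δ ≤ y → 0 ≤ R.eval y) :
    ∃ A B : ℝ[X], IsSumSq A ∧ IsSumSq B ∧ R = A + (X - C δ) * B := by
  have hC : ∀ c : ℝ, 0 ≤ c → IsSumSq (C c : ℝ[X]) := fun c hc => by
    rw [← Real.mul_self_sqrt hc, C_mul]
    exact IsSumSq.mul_self _
  have hmul : ∀ P Q : ℝ[X], (∃ A B : ℝ[X], IsSumSq A ∧ IsSumSq B ∧ P = A + (X - C δ) * B) →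
      (∃ A B : ℝ[X], IsSumSq A ∧ IsSumSq B ∧ Q = A + (X - C δ) * B) →
      ∃ A B : ℝ[X], IsSumSq A ∧ IsSumSq B ∧ P * Q = A + (X - C δ) * B := by
    rintro P Q ⟨A, B, hA, hB, rfl⟩ ⟨A', B', hA', hB', rfl⟩
    exact ⟨A * A' + (X - C δ) * (X - C δ) * (B * B'), A * B' + B * A',
      (hA.mul hA').add ((IsSumSq.mul_self _).mul (hB.mul hB')),
      (hA.mul hB').add (hB.mul hA'), by ring⟩
  -- nonnegativity off a point extends to that point
  have hcont : ∀ (P : ℝ[X]) (z : ℝ), (∀ y, δ ≤ y → y ≠ z → 0 ≤ P.eval y) →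
      ∀ y, δ ≤ y → 0 ≤ P.eval y := by
    intro P z hP y hy
    rcases ne_or_eq y z with h | rfl
    · exact hP y hy h
    · have ht : Filter.Tendsto (fun x => P.eval x) (nhdsWithin y (Set.Ioi y)) (nhds (P.eval y)) :=
        (P.continuous.tendsto y).mono_left nhdsWithin_le_nhds
      refine ge_of_tendsto ht ?_
      filter_upwards [self_mem_nhdsWithin] with x hx
      exact hP x (hy.trans (le_of_lt hx)) (ne_of_gt hx)
  induction hn : R.natDegree using Nat.strong_induction_on generalizing R with
  | _ n ih =>
  have hdeg : ∀ P Q : ℝ[X], P * Q ≠ 0 → 0 < P.natDegree → (P * Q).natDegree = n →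
      Q.natDegree < n := by
    intro P Q h hP hPQ
    rw [natDegree_mul (left_ne_zero_of_mul h) (right_ne_zero_of_mul h)] at hPQ
    omega
  rcases eq_or_ne R 0 with rfl | hR0
  · exact ⟨0, 0, .zero, .zero, by simp⟩
  rcases Nat.eq_zero_or_pos n with h0 | hpos
  · rw [h0] at hn
    rw [eq_C_of_natDegree_eq_zero hn] at hR ⊢
    exact ⟨_, 0, hC _ (by simpa using hR δ le_rfl), .zero, by simp⟩
  obtain ⟨z, hz⟩ : ∃ z : ℂ, aeval z R = 0 := by
    apply IsAlgClosed.exists_aeval_eq_zero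
    rw [degree_eq_natDegree hR0, hn]
    exact_mod_cast hpos.ne'
  by_cases him : z.im = 0
  · obtain ⟨a, rfl⟩ : ∃ a : ℝ, (a : ℂ) = z := ⟨z.re, Complex.ext (by simp) (by simp [him])⟩
    have ha : R.IsRoot a := by
      have : ((R.eval a : ℝ) : ℂ) = 0 := by
        rw [← hz]; simpa using (aeval_algebraMap_apply ℂ a R).symm
      exact_mod_cast this
    obtain ⟨S, rfl⟩ := dvd_iff_isRoot.2 ha
    -- A root `a ≤ δ` contributes `X - a = (δ - a) + (X - δ)`. At a root `a > δ` the polynomial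
    -- cannot change sign, so the root is at least double and a square splits off.
    rcases le_or_gt a δ with haδ | haδ
    · obtain hS := ih _ (hdeg _ _ hR0 (by simp) hn) S (hcont S δ fun y hy hyδ => by
        have h1 : 0 < y - a := by
          have := lt_of_le_of_ne hy (Ne.symm hyδ); linarith
        have h2 := hR y hy
        simp only [eval_mul, eval_sub, eval_X, eval_C] at h2
        exact nonneg_of_mul_nonneg_right h2 h1) rfl
      refine hmul _ _ ⟨C (δ - a), 1, hC _ (by linarith), .one, ?_⟩ hS
      simp [C_sub]
    · have hS1 : ∀ y, δ ≤ y → 0 ≤ (y - a) * S.eval y := fun y hy => by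
        simpa using hR y hy
      have hSa : S.IsRoot a := by
        refine le_antisymm ?_ ?_
        · have ht : Filter.Tendsto (fun x => S.eval x) (nhdsWithin a (Set.Iio a))
              (nhds (S.eval a)) := (S.continuous.tendsto a).mono_left nhdsWithin_le_nhds
          refine le_of_tendsto ht ?_
          filter_upwards [self_mem_nhdsWithin,
            mem_nhdsWithin_of_mem_nhds (Ioi_mem_nhds haδ)] with x hx hx'
          have h3 := hS1 x (le_of_lt hx')
          have h4 : x < a := hx
          by_contra! h
          nlinarith
        · have ht : Filter.Tendsto (fun x => S.eval x) (nhdsWithin a (Set.Ioi a))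
              (nhds (S.eval a)) := (S.continuous.tendsto a).mono_left nhdsWithin_le_nhds
          refine ge_of_tendsto ht ?_
          filter_upwards [self_mem_nhdsWithin] with x hx
          have h4 : a < x := hx
          have h3 := hS1 x (by linarith)
          by_contra! h
          nlinarith
      obtain ⟨T, rfl⟩ := dvd_iff_isRoot.2 hSa
      rw [← mul_assoc] at hR hR0 hn ⊢
      have hT := ih _ (hdeg _ _ hR0 (by
        rw [natDegree_mul (X_sub_C_ne_zero a) (X_sub_C_ne_zero a)]; simp) hn) T
        (hcont T a fun y hy hya => by
          have h1 : 0 < (y - a) * (y - a) := mul_self_pos.2 (sub_ne_zero.2 hya)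
          have h2 := hR y hy
          simp only [eval_mul, eval_sub, eval_X, eval_C] at h2
          exact nonneg_of_mul_nonneg_right h2 h1) rfl
      exact hmul _ _ ⟨(X - C a) * (X - C a), 0, .mul_self _, .zero, by simp⟩ hT
  · obtain ⟨S, rfl⟩ := R.quadratic_dvd_of_aeval_eq_zero_im_ne_zero hz him
    have hq : (X ^ 2 - C (2 * z.re) * X + C (‖z‖ ^ 2) : ℝ[X])
        = (X - C z.re) * (X - C z.re) + C (z.im * z.im) := by
      have : ‖z‖ ^ 2 = z.re * z.re + z.im * z.im := by
        rw [Complex.sq_norm, Complex.normSq_apply]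
      rw [this]
      simp only [C_mul, C_add, map_ofNat]
      ring
    have hqd : 0 < (X ^ 2 - C (2 * z.re) * X + C (‖z‖ ^ 2) : ℝ[X]).natDegree := by
      have : (X ^ 2 - C (2 * z.re) * X + C (‖z‖ ^ 2) : ℝ[X]).natDegree = 2 := by
        compute_degree!
      omega
    have hS := ih _ (hdeg _ _ hR0 hqd hn) S (fun y hy => by
      have h2 := hR y hy
      rw [hq] at h2
      simp only [eval_mul, eval_add, eval_sub, eval_X, eval_C] at h2
      have h1 : 0 < (y - z.re) * (y - z.re) + z.im * z.im :=
        add_pos_of_nonneg_of_pos (mul_self_nonneg _) (mul_self_pos.2 him)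
      exact nonneg_of_mul_nonneg_right h2 h1) rfl
    refine hmul _ _ ⟨(X - C z.re) * (X - C z.re) + C (z.im * z.im), 0, ?_, .zero,
      by rw [hq]; simp⟩ hS
    exact (IsSumSq.mul_self _).add (hC _ (mul_self_nonneg _))

open Polynomial in
/-- A sum of squares dominates a single square that has the same value at a given point. -/
theorem IsSumSq.exists_sq_le {B : ℝ[X]} (hB : IsSumSq B) (t : ℝ) :
    ∃ b : ℝ[X], b.eval t ^ 2 = B.eval t ∧ ∀ y, b.eval y ^ 2 ≤ B.eval y := by
  induction hB with
  | zero => exact ⟨0, by simp, by simp⟩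
  | @sq_add c B' _ ih =>
    obtain ⟨b, hbt, hb⟩ := ih
    set d := c.eval t ^ 2 + b.eval t ^ 2 with hd
    rcases eq_or_ne d 0 with h0 | h0
    · refine ⟨0, ?_, fun y => ?_⟩
      · simp only [eval_zero, eval_add, eval_mul, ← hbt]
        rw [← sq, ← hd, h0]; simp
      · simp only [eval_zero, eval_add, eval_mul]
        nlinarith [hb y, sq_nonneg (b.eval y), mul_self_nonneg (c.eval y)]
    · have hdpos : 0 < d := lt_of_le_of_ne (by positivity) h0.symm
      -- The new polynomial is the component of `(c, b)` along the unit vector `(c(t), b(t)) / √d`.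
      -- Cauchy–Schwarz gives the upper bound, with equality at `t`.
      have key : ∀ y, (C (√d)⁻¹ * (C (c.eval t) * c + C (b.eval t) * b)).eval y ^ 2
          = (c.eval t * c.eval y + b.eval t * b.eval y) ^ 2 / d := fun y => by
        simp only [eval_mul, eval_C, eval_add, mul_pow, inv_pow, Real.sq_sqrt hdpos.le]
        field_simp
      refine ⟨C (√d)⁻¹ * (C (c.eval t) * c + C (b.eval t) * b), ?_, fun y => ?_⟩
      · rw [key, eval_add, eval_mul, ← hbt, div_eq_iff h0, hd]; ring
      · rw [key, eval_add, eval_mul, div_le_iff₀ hdpos]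
        nlinarith [mul_le_mul_of_nonneg_right (hb y) hdpos.le,
          sq_nonneg (c.eval t * b.eval y - b.eval t * c.eval y)]

/-! ### Extremal positive extensions of a functional on polynomials -/

open Polynomial in
/-- The continuous real functions of at most polynomial growth. -/
def polynomialGrowth : Submodule ℝ (ℝ → ℝ) where
  carrier := {g | Continuous g ∧ ∃ q : ℝ[X], ∀ x, |g x| ≤ q.eval x}
  add_mem' := by
    rintro f g ⟨hf, p, hp⟩ ⟨hg, q, hq⟩
    refine ⟨hf.add hg, p + q, fun x => ?_⟩
    rw [eval_add]
    exact (abs_add_le _ _).trans (add_le_add (hp x) (hq x))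
  zero_mem' := ⟨continuous_const, 0, by simp⟩
  smul_mem' := by
    rintro c f ⟨hf, p, hp⟩
    refine ⟨hf.const_smul c, C |c| * p, fun x => ?_⟩
    simp only [Pi.smul_apply, smul_eq_mul, abs_mul, eval_mul, eval_C]
    exact mul_le_mul_of_nonneg_left (hp x) (abs_nonneg c)

namespace polynomialGrowth

open Polynomial

theorem eval_mem (p : ℝ[X]) : (fun x => p.eval x) ∈ polynomialGrowth :=
  ⟨p.continuous, p ^ 2 + 1, fun x => by
    simp only [eval_add, eval_pow, eval_one]
    rw [abs_le]; constructor <;> nlinarith [sq_nonneg (p.eval x - 1), sq_nonneg (p.eval x + 1)]⟩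

/-- Polynomial functions, as elements of `polynomialGrowth`. -/
def ofPolynomial : ℝ[X] →ₗ[ℝ] polynomialGrowth where
  toFun p := ⟨fun x => p.eval x, eval_mem p⟩
  map_add' p q := by ext x; simp
  map_smul' c p := by ext x; simp

@[simp] theorem ofPolynomial_apply (p : ℝ[X]) (x : ℝ) :
    (ofPolynomial p : ℝ → ℝ) x = p.eval x := rfl

theorem mem_of_abs_le {f : ℝ → ℝ} (hf : Continuous f) {g : ℝ → ℝ} (hg : g ∈ polynomialGrowth)
    (h : ∀ x, |f x| ≤ |g x|) : f ∈ polynomialGrowth := by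
  obtain ⟨-, q, hq⟩ := hg
  exact ⟨hf, q, fun x => (h x).trans (hq x)⟩

theorem mul_mem {f g : ℝ → ℝ} (hf : f ∈ polynomialGrowth) (hg : g ∈ polynomialGrowth) :
    (fun x => f x * g x) ∈ polynomialGrowth := by
  obtain ⟨hf, p, hp⟩ := hf
  obtain ⟨hg, q, hq⟩ := hg
  refine ⟨hf.mul hg, p * q, fun x => ?_⟩
  rw [abs_mul, eval_mul]
  exact mul_le_mul (hp x) (hq x) (abs_nonneg _) ((abs_nonneg _).trans (hp x))

theorem mem_of_hasCompactSupport {f : ℝ → ℝ} (hf : Continuous f) (h : HasCompactSupport f) :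
    f ∈ polynomialGrowth := by
  obtain ⟨C, hC⟩ := hf.bounded_above_of_compact_support h
  exact ⟨hf, Polynomial.C C, fun x => by simpa using hC x⟩

/-- A linear functional on polynomials that is positive on `[δ, ∞)` extends to a positive functional
on the functions of polynomial growth which takes the largest possible value at a given `f`. -/
theorem exists_extension (δ : ℝ) (L : ℝ[X] →ₗ[ℝ] ℝ)
    (hL : ∀ q : ℝ[X], (∀ y, δ ≤ y → 0 ≤ q.eval y) → 0 ≤ L q)
    (f : polynomialGrowth) (hf : f ≠ 0) :
    ∃ Λ : polynomialGrowth →ₗ[ℝ] ℝ, (∀ p, Λ (ofPolynomial p) = L p) ∧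
      (∀ g : polynomialGrowth, (∀ y, δ ≤ y → 0 ≤ (g : ℝ → ℝ) y) → 0 ≤ Λ g) ∧
      ∀ ε > 0, ∃ q : ℝ[X], (∀ y, δ ≤ y → (f : ℝ → ℝ) y ≤ q.eval y) ∧ L q < Λ f + ε := by
  let S : polynomialGrowth → Set ℝ := fun g =>
    {r | ∃ q : ℝ[X], (∀ y, δ ≤ y → (g : ℝ → ℝ) y ≤ q.eval y) ∧ L q = r}
  -- The infimum of `L` over polynomial majorants is sublinear. Prescribing the value `N f` on the
  -- line through `f` and dominating by `N` gives the extension that is maximal at `f`.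
  let N : polynomialGrowth → ℝ := fun g => sInf (S g)
  have hne : ∀ g, (S g).Nonempty := fun ⟨g, _, q, hq⟩ =>
    ⟨L q, q, fun y _ => (le_abs_self _).trans (hq y), rfl⟩
  have hbdd : ∀ g, BddBelow (S g) := by
    rintro ⟨g, -, q, hq⟩
    refine ⟨-L q, ?_⟩
    rintro _ ⟨p, hp, rfl⟩
    have := hL (p + q) fun y hy => by
      have h1 := hp y hy
      have h2 := neg_le_of_abs_le (hq y)
      simp only [eval_add] at *
      linarith
    rw [map_add] at this
    linarith
  have hle : ∀ (g : polynomialGrowth) (q : ℝ[X]),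
      (∀ y, δ ≤ y → (g : ℝ → ℝ) y ≤ q.eval y) → N g ≤ L q :=
    fun g q h => csInf_le (hbdd g) ⟨q, h, rfl⟩
  have hlt : ∀ g : polynomialGrowth, ∀ ε > 0, ∃ q : ℝ[X], (∀ y, δ ≤ y → (g : ℝ → ℝ) y ≤ q.eval y) ∧
      L q < N g + ε := fun g ε hε => by
    obtain ⟨_, ⟨q, hq, rfl⟩, h⟩ := Real.lt_sInf_add_pos (hne g) hε
    exact ⟨q, hq, h⟩
  have hadd : ∀ g h, N (g + h) ≤ N g + N h := fun g h => by
    refine le_of_forall_pos_le_add fun ε hε => ?_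
    obtain ⟨p, hp, hp'⟩ := hlt g (ε / 2) (half_pos hε)
    obtain ⟨q, hq, hq'⟩ := hlt h (ε / 2) (half_pos hε)
    have := hle (g + h) (p + q) fun y hy => by
      rw [eval_add]; exact add_le_add (hp y hy) (hq y hy)
    rw [map_add] at this
    linarith
  have hhom' : ∀ c : ℝ, 0 < c → ∀ g, N (c • g) ≤ c * N g := fun c hc g => by
    refine le_of_forall_pos_le_add fun ε hε => ?_
    obtain ⟨p, hp, hp'⟩ := hlt g (ε / c) (div_pos hε hc)
    have := hle (c • g) (c • p) fun y hy => by
      rw [eval_smul]; exact mul_le_mul_of_nonneg_left (hp y hy) hc.le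
    rw [map_smul, smul_eq_mul] at this
    have h2 := mul_lt_mul_of_pos_left hp' hc
    rw [mul_add, mul_div_cancel₀ _ hc.ne'] at h2
    linarith
  have hhom : ∀ c : ℝ, 0 < c → ∀ g, N (c • g) = c * N g := fun c hc g => by
    refine le_antisymm (hhom' c hc g) ?_
    have := hhom' c⁻¹ (inv_pos.2 hc) (c • g)
    rw [inv_smul_smul₀ hc.ne'] at this
    calc c * N g ≤ c * (c⁻¹ * N (c • g)) := mul_le_mul_of_nonneg_left this hc.le
      _ = N (c • g) := by rw [mul_inv_cancel_left₀ hc.ne']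
  have hN0 : N 0 = 0 := by
    have := hhom 2 two_pos 0
    rw [smul_zero] at this
    linarith
  obtain ⟨Λ, hΛf, hΛ⟩ := exists_extension_of_le_sublinear
    (LinearPMap.mkSpanSingleton f (N f) hf) N hhom hadd (by
      rintro ⟨x, hx⟩
      obtain ⟨c, rfl⟩ := Submodule.mem_span_singleton.1 hx
      rw [LinearPMap.mkSpanSingleton'_apply, smul_eq_mul]
      change c * N f ≤ N (c • f)
      rcases lt_trichotomy c 0 with hc | rfl | hc
      · have h1 := hadd (c • f) ((-c) • f)
        rw [← add_smul, add_neg_cancel, zero_smul, hN0, hhom (-c) (neg_pos.2 hc)] at h1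
        linarith
      · simp [hN0]
      · exact (hhom c hc f).ge)
  have hpol : ∀ p, Λ (ofPolynomial p) ≤ L p := fun p =>
    (hΛ _).trans (hle _ p fun y _ => le_rfl)
  refine ⟨Λ, fun p => le_antisymm (hpol p) ?_, fun g hg => ?_, ?_⟩
  · have := hpol (-p)
    rw [map_neg, map_neg, map_neg] at this
    linarith
  -- Positivity follows from domination: the zero polynomial majorizes `-g`.
  · have h1 := (hΛ (-g)).trans (hle (-g) 0 fun y hy => by simpa using hg y hy)
    rw [map_neg, map_zero] at h1
    linarith
  · have : Λ f = N f := by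
      have := hΛf ⟨f, Submodule.mem_span_singleton_self f⟩
      rw [this]
      exact LinearPMap.mkSpanSingleton_apply ℝ ℝ hf (N f)
    rw [this]
    exact hlt f

end polynomialGrowth

/-! ### Representation of positive functionals by measures -/

namespace polynomialGrowth

open Polynomial Filter Topology
open scoped CompactlySupported

/-- A piecewise linear cutoff function, equal to `1` on `[-(n + 1), n + 1]`. -/
def cutoff (n : ℕ) (x : ℝ) : ℝ := max 0 (min 1 (n + 2 - |x|))

theorem continuous_cutoff (n : ℕ) : Continuous (cutoff n) := by
  unfold cutoff; fun_prop

theorem cutoff_nonneg (n : ℕ) (x : ℝ) : 0 ≤ cutoff n x := le_max_left _ _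

theorem cutoff_le_one (n : ℕ) (x : ℝ) : cutoff n x ≤ 1 :=
  max_le zero_le_one (min_le_left _ _)

theorem hasCompactSupport_cutoff (n : ℕ) : HasCompactSupport (cutoff n) := by
  refine HasCompactSupport.intro (isCompact_closedBall (0 : ℝ) (n + 2)) fun x hx => ?_
  rw [mem_closedBall_zero_iff, Real.norm_eq_abs, not_le] at hx
  exact max_eq_left ((min_le_right _ _).trans (by linarith))

theorem monotone_cutoff (x : ℝ) : Monotone fun n => cutoff n x := fun m n h => by
  have : (m : ℝ) ≤ n := by exact_mod_cast h
  exact max_le_max le_rfl (min_le_min le_rfl (by linarith))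

theorem one_sub_cutoff_le (n : ℕ) (x : ℝ) : 1 - cutoff n x ≤ x ^ 2 / (n + 1) := by
  have hn : (0 : ℝ) < n + 1 := by positivity
  rcases le_or_gt |x| (n + 1) with h | h
  · have : cutoff n x = 1 := by
      rw [cutoff, min_eq_left (by linarith), max_eq_right zero_le_one]
    rw [this, sub_self]
    positivity
  · rw [le_div_iff₀ hn, ← sq_abs]
    have := cutoff_nonneg n x
    nlinarith [(Nat.cast_nonneg n : (0 : ℝ) ≤ n)]

theorem tendsto_cutoff (x : ℝ) : Tendsto (fun n => cutoff n x) atTop (𝓝 1) := by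
  have h : Tendsto (fun n : ℕ => 1 - x ^ 2 / ((n : ℝ) + 1)) atTop (𝓝 (1 - 0)) :=
    tendsto_const_nhds.sub (tendsto_const_nhds.div_atTop
      (tendsto_atTop_add_const_right _ _ tendsto_natCast_atTop_atTop))
  rw [sub_zero] at h
  exact tendsto_of_tendsto_of_tendsto_of_le_of_le h tendsto_const_nhds
    (fun n => by linarith [one_sub_cutoff_le n x]) fun n => cutoff_le_one n x

/-- A positive linear functional on the functions of polynomial growth is integration against a
measure. -/
theorem exists_measure (Λ : polynomialGrowth →ₗ[ℝ] ℝ)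
    (hΛ : ∀ g : polynomialGrowth, (∀ y, 0 ≤ (g : ℝ → ℝ) y) → 0 ≤ Λ g) :
    ∃ μ : Measure ℝ, ∀ g : polynomialGrowth,
      Integrable (g : ℝ → ℝ) μ ∧ ∫ x, (g : ℝ → ℝ) x ∂μ = Λ g := by
  let ι : C_c(ℝ, ℝ) →ₗ[ℝ] polynomialGrowth :=
    { toFun := fun g => ⟨g, mem_of_hasCompactSupport g.continuous g.hasCompactSupport⟩
      map_add' := fun _ _ => rfl
      map_smul' := fun _ _ => rfl }
  let Φ : C_c(ℝ, ℝ) →ₚ[ℝ] ℝ := PositiveLinearMap.mk₀ (Λ ∘ₗ ι) fun g hg => hΛ _ hg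
  let μ := RealRMK.rieszMeasure Φ
  have hμ : ∀ g : C_c(ℝ, ℝ), ∫ x, g x ∂μ = Λ (ι g) := RealRMK.integral_rieszMeasure Φ
  have hmono : ∀ f g : polynomialGrowth, (∀ y, (f : ℝ → ℝ) y ≤ (g : ℝ → ℝ) y) → Λ f ≤ Λ g :=
      fun f g h => by
    have := hΛ (g - f) fun y => sub_nonneg.2 (h y)
    rw [map_sub] at this
    linarith
  have hpos : ∀ g : polynomialGrowth, (∀ y, 0 ≤ (g : ℝ → ℝ) y) →
      Integrable (g : ℝ → ℝ) μ ∧ ∫ x, (g : ℝ → ℝ) x ∂μ = Λ g := fun g hg => by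
    let G : ℕ → C_c(ℝ, ℝ) := fun n =>
      ⟨⟨fun x => (g : ℝ → ℝ) x * cutoff n x, g.2.1.mul (continuous_cutoff n)⟩,
        (hasCompactSupport_cutoff n).mul_left⟩
    let g₂ : polynomialGrowth :=
      ⟨fun x => (g : ℝ → ℝ) x * (X ^ 2 : ℝ[X]).eval x, mul_mem g.2 (eval_mem _)⟩
    have hG0 : ∀ n x, 0 ≤ G n x := fun n x => mul_nonneg (hg x) (cutoff_nonneg n x)
    have hle : ∀ n, Λ (ι (G n)) ≤ Λ g := fun n => hmono _ _ fun y =>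
      mul_le_of_le_one_right (hg y) (cutoff_le_one n y)
    -- No mass escapes to infinity: the part of `g` cut off is at most `x² g / (n + 1)`, which still
    -- has polynomial growth.
    have hge : ∀ n : ℕ, Λ g - Λ g₂ / (n + 1) ≤ Λ (ι (G n)) := fun n => by
      have := hmono (g - ((n : ℝ) + 1)⁻¹ • g₂) (ι (G n)) fun y => by
        change (g : ℝ → ℝ) y - ((n : ℝ) + 1)⁻¹ * ((g : ℝ → ℝ) y * (X ^ 2 : ℝ[X]).eval y)
          ≤ (g : ℝ → ℝ) y * cutoff n y
        have h1 := mul_le_mul_of_nonneg_left (one_sub_cutoff_le n y) (hg y)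
        rw [eval_pow, eval_X]
        have h2 : ((n : ℝ) + 1)⁻¹ * ((g : ℝ → ℝ) y * y ^ 2)
            = (g : ℝ → ℝ) y * (y ^ 2 / (n + 1)) := by
          field_simp
        rw [h2]
        linarith
      rw [map_sub, map_smul, smul_eq_mul] at this
      rwa [div_eq_inv_mul]
    have hlim : Tendsto (fun n => Λ (ι (G n))) atTop (𝓝 (Λ g)) := by
      have h : Tendsto (fun n : ℕ => Λ g - Λ g₂ / ((n : ℝ) + 1)) atTop (𝓝 (Λ g - 0)) :=
        tendsto_const_nhds.sub (tendsto_const_nhds.div_atTop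
          (tendsto_atTop_add_const_right _ _ tendsto_natCast_atTop_atTop))
      rw [sub_zero] at h
      exact tendsto_of_tendsto_of_tendsto_of_le_of_le h tendsto_const_nhds hge hle
    have hint : ∀ n, ∫⁻ x, ENNReal.ofReal (G n x) ∂μ = ENNReal.ofReal (Λ (ι (G n))) := fun n => by
      have hi : Integrable (fun x => G n x) μ :=
        (G n).continuous.integrable_of_hasCompactSupport (G n).hasCompactSupport
      rw [← hμ, ofReal_integral_eq_lintegral_ofReal hi (Eventually.of_forall (hG0 n))]
    have hlim' : Tendsto (fun n => ∫⁻ x, ENNReal.ofReal (G n x) ∂μ) atTop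
        (𝓝 (∫⁻ x, ENNReal.ofReal ((g : ℝ → ℝ) x) ∂μ)) := by
      refine lintegral_tendsto_of_tendsto_of_monotone
        (fun n => (ENNReal.continuous_ofReal.comp (G n).continuous).measurable.aemeasurable)
        (Eventually.of_forall fun x m n h => ENNReal.ofReal_le_ofReal
          (mul_le_mul_of_nonneg_left (monotone_cutoff x h) (hg x)))
        (Eventually.of_forall fun x => ?_)
      refine (ENNReal.continuous_ofReal.tendsto _).comp ?_
      have := (tendsto_cutoff x).const_mul ((g : ℝ → ℝ) x)
      rwa [mul_one] at this
    have hl : ∫⁻ x, ENNReal.ofReal ((g : ℝ → ℝ) x) ∂μ = ENNReal.ofReal (Λ g) := by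
      simp only [hint] at hlim'
      exact tendsto_nhds_unique hlim' ((ENNReal.continuous_ofReal.tendsto _).comp hlim)
    have hm : AEStronglyMeasurable (g : ℝ → ℝ) μ := g.2.1.aestronglyMeasurable
    refine ⟨⟨hm, ?_⟩, ?_⟩
    · rw [hasFiniteIntegral_iff_ofReal (Eventually.of_forall hg), hl]
      exact ENNReal.ofReal_lt_top
    · rw [integral_eq_lintegral_of_nonneg_ae (Eventually.of_forall hg) hm, hl,
        ENNReal.toReal_ofReal (hΛ g hg)]
  refine ⟨μ, fun g => ?_⟩
  -- A general `g` is the difference of the nonnegative functions `q` and `q - g`.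
  obtain ⟨q, hq⟩ := g.2.2
  obtain ⟨i1, e1⟩ := hpos (ofPolynomial q) fun y => (abs_nonneg _).trans (hq y)
  obtain ⟨i2, e2⟩ := hpos (ofPolynomial q - g) fun y =>
    sub_nonneg.2 ((le_abs_self _).trans (hq y))
  have h : (g : ℝ → ℝ) = fun x =>
      (ofPolynomial q : ℝ → ℝ) x - (ofPolynomial q - g : polynomialGrowth).1 x := by
    ext x; simp
  refine ⟨h ▸ i1.sub i2, ?_⟩
  calc ∫ x, (g : ℝ → ℝ) x ∂μ
      = ∫ x, (ofPolynomial q : ℝ → ℝ) x - (ofPolynomial q - g : polynomialGrowth).1 x ∂μ :=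
        congrArg (fun f : ℝ → ℝ => ∫ x, f x ∂μ) h
    _ = Λ g := by rw [integral_sub i1 i2, e1, e2, map_sub]; ring

end polynomialGrowth

/-! ### Consequences of uniqueness on a closed half-line -/

open Polynomial in
theorem IsMomentSolutionOn.integrable_eval {I : Set ℝ} {s : ℕ → ℝ} {μ : Measure ℝ}
    (h : IsMomentSolutionOn I s μ) (p : ℝ[X]) : Integrable (fun x => p.eval x) μ := by
  simp only [eval_eq_sum_range]
  exact integrable_finsetSum _ fun k _ => (h.integrable_pow k).const_mul _

open Polynomial in
theorem IsMomentSolutionOn.integral_eval {I : Set ℝ} {s : ℕ → ℝ} {μ : Measure ℝ}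
    (h : IsMomentSolutionOn I s μ) (p : ℝ[X]) : ∫ x, p.eval x ∂μ = p.sum fun k c => c * s k := by
  simp only [eval_eq_sum, Polynomial.sum]
  rw [integral_finsetSum _ fun k _ => (h.integrable_pow k).const_mul _]
  simp only [integral_const_mul, h.moment_eq]

theorem IsMomentSolutionOn.isFiniteMeasure {I : Set ℝ} {s : ℕ → ℝ} {μ : Measure ℝ}
    (h : IsMomentSolutionOn I s μ) : IsFiniteMeasure μ := by
  have := h.integrable_pow 0
  simp only [pow_zero] at this
  exact (integrable_const_iff_isFiniteMeasure one_ne_zero).1 this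

theorem IsMomentSolutionOn.ae_mem {I : Set ℝ} {s : ℕ → ℝ} {μ : Measure ℝ}
    (h : IsMomentSolutionOn I s μ) : ∀ᵐ x ∂μ, x ∈ I :=
  Filter.mem_of_superset μ.support_mem_ae h.support_subset

open Polynomial in
/-- If the moment problem on `[δ, ∞)` has only one solution `μ`, then every continuous function `f`
of polynomial growth has polynomial majorants on `[δ, ∞)` whose integrals are arbitrarily close to
that of `f`. -/
theorem IsMomentSolutionOn.exists_polynomial_majorant {δ : ℝ} {s : ℕ → ℝ} {μ : Measure ℝ}
    (h : IsMomentSolutionOn (Set.Ici δ) s μ)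
    (huniq : ∀ μ', IsMomentSolutionOn (Set.Ici δ) s μ' → μ' = μ)
    {f : ℝ → ℝ} (hf : f ∈ polynomialGrowth) (hf0 : f ≠ 0) {ε : ℝ} (hε : 0 < ε) :
    ∃ q : ℝ[X], (∀ y, δ ≤ y → f y ≤ q.eval y) ∧ ∫ x, q.eval x ∂μ < ∫ x, f x ∂μ + ε := by
  let L : ℝ[X] →ₗ[ℝ] ℝ :=
    { toFun := fun p => ∫ x, p.eval x ∂μ
      map_add' := fun p q => by
        simp only [eval_add]
        exact integral_add (h.integrable_eval p) (h.integrable_eval q)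
      map_smul' := fun c p => by
        simp only [eval_smul, smul_eq_mul, RingHom.id_apply]
        exact integral_const_mul c _ }
  obtain ⟨Λ, hΛL, hΛ0, hΛf⟩ := polynomialGrowth.exists_extension δ L
    (fun q hq => integral_nonneg_of_ae (h.ae_mem.mono fun x hx => hq x hx)) ⟨f, hf⟩
    fun h0 => hf0 (congrArg Subtype.val h0)
  obtain ⟨μ', hμ'⟩ := polynomialGrowth.exists_measure Λ fun g hg => hΛ0 g fun y _ => hg y
  have hpow : ∀ k : ℕ, (polynomialGrowth.ofPolynomial (X ^ k) : ℝ → ℝ) = fun x => x ^ k :=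
      fun k => by
    ext x; simp
  have hsol : IsMomentSolutionOn (Set.Ici δ) s μ' := by
    refine ⟨?_, fun k => ?_, fun k => ?_⟩
    · refine Measure.support_subset_of_isClosed isClosed_Ici ?_
      -- This function vanishes exactly on `[δ, ∞)`. Since `Λ` is positive for the order on `[δ,
      -- ∞)`, it is killed by `Λ`, so `μ'` is carried by that half-line.
      have hmem : (fun y => max 0 (δ - y)) ∈ polynomialGrowth :=
        polynomialGrowth.mem_of_abs_le (by fun_prop)
          (polynomialGrowth.eval_mem (C δ - X)) fun x => by
            simp only [eval_sub, eval_C, eval_X]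
            rw [abs_of_nonneg (le_max_left _ _)]
            exact max_le (abs_nonneg _) (le_abs_self _)
      have hz : Λ ⟨_, hmem⟩ = 0 := by
        refine le_antisymm ?_ (hΛ0 _ fun y _ => le_max_left _ _)
        have := hΛ0 (-⟨_, hmem⟩) fun y hy => by
          change 0 ≤ -max 0 (δ - y)
          rw [max_eq_left (by linarith), neg_zero]
        rw [map_neg] at this
        linarith
      obtain ⟨hi, he⟩ := hμ' ⟨_, hmem⟩
      rw [hz] at he
      have := (integral_eq_zero_iff_of_nonneg (fun y => le_max_left _ _) hi).1 he
      filter_upwards [this] with y hy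
      have h1 : max 0 (δ - y) = 0 := hy
      have h2 := le_max_right 0 (δ - y)
      change δ ≤ y
      linarith
    · rw [← hpow]; exact (hμ' _).1
    · have := (hμ' (polynomialGrowth.ofPolynomial (X ^ k))).2
      rw [hpow, hΛL] at this
      rw [this, ← h.moment_eq k]
      change ∫ x, (X ^ k : ℝ[X]).eval x ∂μ = _
      simp
  obtain rfl := huniq μ' hsol
  obtain ⟨q, hq, hq'⟩ := hΛf ε hε
  exact ⟨q, hq, by rw [← (hμ' ⟨f, hf⟩).2] at hq'; exact hq'⟩

open Polynomial in
/-- If the moment problem on `[δ, ∞)` has only one solution, there are polynomials with value `1` at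
`-1` that are arbitrarily small in the mean with weight `(y - δ) / (1 + y)`. -/
theorem IsMomentSolutionOn.exists_polynomial_eval_neg_one {δ : ℝ} (hδ : 0 ≤ δ) {s : ℕ → ℝ}
    {μ : Measure ℝ} (h : IsMomentSolutionOn (Set.Ici δ) s μ)
    (huniq : ∀ μ', IsMomentSolutionOn (Set.Ici δ) s μ' → μ' = μ) {ε : ℝ} (hε : 0 < ε) :
    ∃ b : ℝ[X], b.eval (-1) = 1 ∧ ∫ y, (y - δ) * b.eval y ^ 2 / (1 + y) ∂μ ≤ ε := by
  have h1δ : 0 < 1 + δ := by linarith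
  have hc : Continuous fun y : ℝ => (1 + |y|)⁻¹ :=
    Continuous.inv₀ (by fun_prop) fun y => by positivity
  have hle : ∀ y : ℝ, |(1 + |y|)⁻¹| ≤ 1 := fun y => by
    rw [abs_of_nonneg (by positivity)]
    exact inv_le_one_of_one_le₀ (by linarith [abs_nonneg y])
  have hf : (fun y : ℝ => (1 + |y|)⁻¹) ∈ polynomialGrowth :=
    polynomialGrowth.mem_of_abs_le hc (polynomialGrowth.eval_mem 1) fun y => by
      rw [eval_one, abs_one]
      exact hle y
  have hfi : Integrable (fun y : ℝ => (1 + |y|)⁻¹) μ :=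
    have := h.isFiniteMeasure
    .of_bound hc.aestronglyMeasurable 1 (.of_forall hle)
  obtain ⟨q, hq, hq'⟩ := h.exists_polynomial_majorant huniq hf
    (fun h0 => by simpa using congrFun h0 0) (div_pos hε h1δ)
  have hQ : ∀ y, δ ≤ y → ((1 + X) * q - 1).eval y / (1 + y) = q.eval y - (1 + |y|)⁻¹ := by
    intro y hy
    have : 0 < 1 + y := by linarith
    rw [abs_of_nonneg (hδ.trans hy)]
    simp only [eval_sub, eval_mul, eval_add, eval_one, eval_X]
    field_simp
  obtain ⟨A, B, hA, hB, hAB⟩ := exists_isSumSq_add_mul_of_nonneg_on_Ici δ ((1 + X) * q - 1)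
    fun y hy => by
      have h1 : 0 < 1 + y := by linarith
      have h2 := hQ y hy
      rw [div_eq_iff h1.ne'] at h2
      rw [h2]
      exact mul_nonneg (sub_nonneg.2 (hq y hy)) h1.le
  -- Only the nonnegativity of `A` is needed; the point `0` is arbitrary.
  obtain ⟨a, -, haA⟩ := hA.exists_sq_le 0
  obtain ⟨b, hbt, hbB⟩ := hB.exists_sq_le (-1)
  -- At `-1` the identity reads `-1 = A(-1) - (1 + δ) B(-1)`.
  have hB1 : 1 ≤ (1 + δ) * B.eval (-1) := by
    have h1 := congrArg (eval (-1)) hAB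
    simp only [eval_sub, eval_mul, eval_add, eval_one, eval_X, eval_C] at h1
    nlinarith [haA (-1), sq_nonneg (a.eval (-1))]
  have hBpos : 0 < B.eval (-1) := pos_of_mul_pos_right (by linarith) h1δ.le
  have hb0 : b.eval (-1) ≠ 0 := fun h0 => by
    rw [h0] at hbt; simp [← hbt] at hBpos
  refine ⟨C (b.eval (-1))⁻¹ * b, by simp [hb0], ?_⟩
  calc ∫ y, (y - δ) * (C (b.eval (-1))⁻¹ * b).eval y ^ 2 / (1 + y) ∂μ
      ≤ ∫ y, (1 + δ) * (q.eval y - (1 + |y|)⁻¹) ∂μ := by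
        refine integral_mono_of_nonneg ?_ ?_ ?_
        · filter_upwards [h.ae_mem] with y hy
          have hy' : δ ≤ y := hy
          exact div_nonneg (mul_nonneg (by linarith) (sq_nonneg _)) (by linarith)
        · exact ((h.integrable_eval q).sub hfi).const_mul _
        · filter_upwards [h.ae_mem] with y hy
          have hy' : δ ≤ y := hy
          have h1 : 0 < 1 + y := by linarith
          have hQy := hQ y hy'
          rw [← hQy, hAB, ← mul_div_assoc, div_le_div_iff_of_pos_right h1]
          simp only [eval_sub, eval_mul, eval_add, eval_X, eval_C, mul_pow, inv_pow]
          rw [hbt]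
          have h2 : (B.eval (-1))⁻¹ * b.eval y ^ 2 ≤ (1 + δ) * B.eval y :=
            mul_le_mul ((inv_le_iff_one_le_mul₀ hBpos).2 hB1) (hbB y) (sq_nonneg _) h1δ.le
          have h3 := mul_le_mul_of_nonneg_left h2 (sub_nonneg.2 hy')
          have h4 : 0 ≤ (1 + δ) * A.eval y :=
            mul_nonneg h1δ.le ((sq_nonneg _).trans (haA y))
          linarith
    _ = (1 + δ) * (∫ y, q.eval y ∂μ - ∫ y, (1 + |y|)⁻¹ ∂μ) := by
        rw [integral_const_mul, integral_sub (h.integrable_eval q) hfi]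
    _ ≤ (1 + δ) * (ε / (1 + δ)) := mul_le_mul_of_nonneg_left (by linarith) h1δ.le
    _ = ε := mul_div_cancel₀ _ h1δ.ne'

/-! ### The `L²` closure of the polynomials and a determinacy criterion -/

namespace PolynomialClosure

open Polynomial
open scoped ComplexConjugate BoundedContinuousFunction

/-- The measurable functions that belong to the closure of the polynomials in `L²(σ)`. -/
def Approx (σ : Measure ℝ) (g : ℝ → ℂ) : Prop :=
  Measurable g ∧ ∀ ε : ENNReal, ε ≠ 0 →
    ∃ p : ℂ[X], eLpNorm (fun x : ℝ => g x - p.eval (x : ℂ)) 2 σ ≤ ε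

variable {σ : Measure ℝ} {f g : ℝ → ℂ}

theorem measurable_eval (p : ℂ[X]) : Measurable fun x : ℝ => p.eval (x : ℂ) :=
  (p.continuous.comp Complex.continuous_ofReal).measurable

theorem approx_eval (σ : Measure ℝ) (p : ℂ[X]) : Approx σ fun x => p.eval (x : ℂ) :=
  ⟨measurable_eval p, fun ε _ => ⟨p, by simp⟩⟩

theorem Approx.add (hf : Approx σ f) (hg : Approx σ g) : Approx σ (f + g) := by
  refine ⟨hf.1.add hg.1, fun ε hε => ?_⟩
  obtain ⟨p, hp⟩ := hf.2 (ε / 2) (ENNReal.half_pos hε).ne'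
  obtain ⟨q, hq⟩ := hg.2 (ε / 2) (ENNReal.half_pos hε).ne'
  refine ⟨p + q, ?_⟩
  calc eLpNorm (fun x : ℝ => (f + g) x - (p + q).eval (x : ℂ)) 2 σ
      = eLpNorm ((fun x : ℝ => f x - p.eval (x : ℂ)) + fun x : ℝ => g x - q.eval (x : ℂ)) 2 σ := by
        congr 1; ext x; simp only [Pi.add_apply, eval_add]; ring
    _ ≤ ε / 2 + ε / 2 := (eLpNorm_add_le (hf.1.sub (measurable_eval p)).aestronglyMeasurable
        (hg.1.sub (measurable_eval q)).aestronglyMeasurable one_le_two).trans (add_le_add hp hq)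
    _ = ε := ENNReal.add_halves ε

theorem Approx.const_mul (hf : Approx σ f) (c : ℂ) : Approx σ fun x => c * f x := by
  refine ⟨hf.1.const_mul c, fun ε hε => ?_⟩
  obtain ⟨p, hp⟩ := hf.2 (ε / (‖c‖ₑ + 1)) (ENNReal.div_pos hε (by simp)).ne'
  refine ⟨C c * p, ?_⟩
  calc eLpNorm (fun x : ℝ => c * f x - (C c * p).eval (x : ℂ)) 2 σ
      = eLpNorm (c • fun x : ℝ => f x - p.eval (x : ℂ)) 2 σ := by
        congr 1; ext x; simp [mul_sub]
    _ = ‖c‖ₑ * eLpNorm (fun x : ℝ => f x - p.eval (x : ℂ)) 2 σ := eLpNorm_const_smul _ _ _ _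
    _ ≤ (‖c‖ₑ + 1) * (ε / (‖c‖ₑ + 1)) := mul_le_mul' le_self_add hp
    _ = ε := ENNReal.mul_div_cancel (by simp) (by simp)

theorem Approx.conj (hf : Approx σ f) : Approx σ fun x => conj (f x) := by
  refine ⟨Complex.continuous_conj.measurable.comp hf.1, fun ε hε => ?_⟩
  obtain ⟨p, hp⟩ := hf.2 ε hε
  refine ⟨p.map (starRingEnd ℂ), le_of_eq_of_le (eLpNorm_congr_norm_ae (.of_forall fun x => ?_)) hp⟩
  have : (p.map (starRingEnd ℂ)).eval (x : ℂ) = conj (p.eval (x : ℂ)) := by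
    conv_lhs => rw [← Complex.conj_ofReal x]
    rw [eval_map, eval₂_hom]
  rw [this, ← map_sub]
  exact Complex.norm_conj _

theorem approx_of_forall_exists (hg : Measurable g)
    (h : ∀ ε : ENNReal, ε ≠ 0 → ∃ f, Approx σ f ∧ eLpNorm (g - f) 2 σ ≤ ε) : Approx σ g := by
  refine ⟨hg, fun ε hε => ?_⟩
  obtain ⟨f, hf, hfg⟩ := h (ε / 2) (ENNReal.half_pos hε).ne'
  obtain ⟨p, hp⟩ := hf.2 (ε / 2) (ENNReal.half_pos hε).ne'
  refine ⟨p, ?_⟩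
  calc eLpNorm (fun x : ℝ => g x - p.eval (x : ℂ)) 2 σ
      = eLpNorm ((g - f) + fun x : ℝ => f x - p.eval (x : ℂ)) 2 σ := by
        congr 1; ext x; simp
    _ ≤ ε / 2 + ε / 2 := (eLpNorm_add_le (hg.sub hf.1).aestronglyMeasurable
        (hf.1.sub (measurable_eval p)).aestronglyMeasurable one_le_two).trans (add_le_add hfg hp)
    _ = ε := ENNReal.add_halves ε

theorem ofReal_sub_I_ne_zero (x : ℝ) : (x : ℂ) - Complex.I ≠ 0 := fun h => by
  simpa using congrArg Complex.im h

theorem sq_norm_ofReal_sub_I (x : ℝ) : ‖(x : ℂ) - Complex.I‖ ^ 2 = 1 + x ^ 2 := by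
  rw [Complex.sq_norm, Complex.normSq_apply]
  simp; ring

theorem norm_inv_ofReal_sub_I_le (x : ℝ) : ‖((x : ℂ) - Complex.I)⁻¹‖ ≤ 1 := by
  rw [norm_inv]
  refine inv_le_one_of_one_le₀ ?_
  have := sq_norm_ofReal_sub_I x
  nlinarith [norm_nonneg ((x : ℂ) - Complex.I), sq_nonneg x]

theorem continuous_inv_ofReal_sub_I : Continuous fun x : ℝ => ((x : ℂ) - Complex.I)⁻¹ :=
  Continuous.inv₀ (by fun_prop) ofReal_sub_I_ne_zero

/-- The function `x ↦ 1 / (x - i)`. -/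
noncomputable def resolvent : ℝ →ᵇ ℂ :=
  BoundedContinuousFunction.ofNormedAddCommGroup (fun x : ℝ => ((x : ℂ) - Complex.I)⁻¹)
    continuous_inv_ofReal_sub_I 1 norm_inv_ofReal_sub_I_le

@[simp] theorem resolvent_apply (x : ℝ) : resolvent x = ((x : ℂ) - Complex.I)⁻¹ := rfl

/-- The closure of the polynomials is stable under multiplication by `1 / (x - i)` as soon as it
contains that function. -/
theorem Approx.resolvent_mul (he : Approx σ resolvent) (hg : Approx σ g) :
    Approx σ fun x => resolvent x * g x := by
  -- Division by `x - i` leaves `p(i) / (x - i)` plus a polynomial. The general case follows because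
  -- `|1 / (x - i)| ≤ 1`.
  have hpol : ∀ p : ℂ[X], Approx σ fun x => resolvent x * p.eval (x : ℂ) := fun p => by
    convert (he.const_mul (p.eval Complex.I)).add (approx_eval σ (p /ₘ (X - C Complex.I))) using 1
    ext x
    have h1 := congrArg (eval (x : ℂ)) (modByMonic_add_div p (X - C Complex.I))
    rw [modByMonic_X_sub_C_eq_C_eval] at h1
    simp only [eval_add, eval_mul, eval_sub, eval_X, eval_C] at h1
    simp only [Pi.add_apply, resolvent_apply]
    rw [← h1]
    field_simp [ofReal_sub_I_ne_zero x]
  refine approx_of_forall_exists (he.1.mul hg.1) fun ε hε => ?_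
  obtain ⟨p, hp⟩ := hg.2 ε hε
  refine ⟨_, hpol p, (eLpNorm_mono fun x => ?_).trans hp⟩
  simp only [Pi.sub_apply]
  rw [← mul_sub, norm_mul]
  exact mul_le_of_le_one_left (norm_nonneg _) (norm_inv_ofReal_sub_I_le x)

/-- The bounded continuous functions which, together with their conjugates, multiply the closure of
the polynomials into itself. -/
noncomputable def multiplierAlgebra (σ : Measure ℝ) : StarSubalgebra ℂ (ℝ →ᵇ ℂ) where
  carrier := {f | (∀ g, Approx σ g → Approx σ fun x => f x * g x) ∧
    ∀ g, Approx σ g → Approx σ fun x => conj (f x) * g x}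
  mul_mem' := by
    rintro f₁ f₂ ⟨h₁, h₁'⟩ ⟨h₂, h₂'⟩
    refine ⟨fun g hg => ?_, fun g hg => ?_⟩
    · simpa [mul_assoc] using h₁ _ (h₂ g hg)
    · simpa [mul_assoc] using h₁' _ (h₂' g hg)
  add_mem' := by
    rintro f₁ f₂ ⟨h₁, h₁'⟩ ⟨h₂, h₂'⟩
    refine ⟨fun g hg => ?_, fun g hg => ?_⟩
    · convert (h₁ g hg).add (h₂ g hg) using 1; ext x; simp [add_mul]
    · convert (h₁' g hg).add (h₂' g hg) using 1; ext x; simp [add_mul]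
  algebraMap_mem' := fun c =>
    ⟨fun g hg => hg.const_mul c, fun g hg => hg.const_mul (conj c)⟩
  star_mem' := by
    rintro f ⟨h, h'⟩
    refine ⟨fun g hg => by simpa using h' g hg, fun g hg => by simpa using h g hg⟩

/-- On the real line the conjugate of a polynomial is a polynomial, so the closure is
self-conjugate; multiplication by `1 / (x + i)` is multiplication by `1 / (x - i)` between two
conjugations. -/
theorem resolvent_mem_multiplierAlgebra (he : Approx σ resolvent) :
    resolvent ∈ multiplierAlgebra σ :=
  ⟨fun _ hg => he.resolvent_mul hg, fun g hg => by
    simpa using (he.resolvent_mul hg.conj).conj⟩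

theorem separatesPoints_of_resolvent_mem {A : StarSubalgebra ℂ (ℝ →ᵇ ℂ)} (h : resolvent ∈ A) :
    (A.map (BoundedContinuousFunction.toContinuousMapStarₐ ℂ)).SeparatesPoints := by
  intro x y hxy
  refine ⟨_, ⟨_, ⟨resolvent, h, rfl⟩, rfl⟩, fun he => hxy ?_⟩
  have : ((x : ℂ) - Complex.I)⁻¹ = ((y : ℂ) - Complex.I)⁻¹ := he
  exact_mod_cast sub_left_injective (inv_injective this)

end PolynomialClosure

namespace PolynomialClosure

open Polynomial
open scoped ComplexConjugate BoundedContinuousFunction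

variable {h : ℕ → ℝ} {ν ν₁ ν₂ : Measure ℝ}

theorem integrable_eval_complex (hν : IsMomentSolutionOn Set.univ h ν) (p : ℂ[X]) :
    Integrable (fun x : ℝ => p.eval (x : ℂ)) ν := by
  simp only [eval_eq_sum_range]
  exact integrable_finsetSum _ fun k _ => by
    simpa using ((hν.integrable_pow k).ofReal (𝕜 := ℂ)).const_mul (p.coeff k)

theorem integral_eval_complex (hν : IsMomentSolutionOn Set.univ h ν) (p : ℂ[X]) :
    ∫ x : ℝ, p.eval (x : ℂ) ∂ν = ∑ k ∈ Finset.range (p.natDegree + 1), p.coeff k * h k := by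
  simp only [eval_eq_sum_range]
  rw [integral_finsetSum _ fun k _ => by
    simpa using ((hν.integrable_pow k).ofReal (𝕜 := ℂ)).const_mul (p.coeff k)]
  refine Finset.sum_congr rfl fun k _ => ?_
  rw [integral_const_mul, ← hν.moment_eq k, ← integral_complex_ofReal]
  simp

theorem norm_integral_le_eLpNorm_two {g : ℝ → ℂ} [IsFiniteMeasure ν] (hg : Measurable g) :
    ‖∫ x, g x ∂ν‖ₑ ≤ eLpNorm g 2 ν * ν Set.univ ^ (1 / 2 : ℝ) := by
  calc ‖∫ x, g x ∂ν‖ₑ ≤ ∫⁻ x, ‖g x‖ₑ ∂ν := enorm_integral_le_lintegral_enorm _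
    _ = eLpNorm g 1 ν := eLpNorm_one_eq_lintegral_enorm.symm
    _ ≤ eLpNorm g 2 ν * ν Set.univ ^ (1 / (1 : ENNReal).toReal - 1 / (2 : ENNReal).toReal) :=
        eLpNorm_le_eLpNorm_mul_rpow_measure_univ one_le_two hg.aestronglyMeasurable
    _ = eLpNorm g 2 ν * ν Set.univ ^ (1 / 2 : ℝ) := by norm_num

/-- Two measures with the same moments give the same integral to the bounded functions in the
`L²`-closure of the polynomials. -/
theorem Approx.integral_eq (h₁ : IsMomentSolutionOn Set.univ h ν₁)
    (h₂ : IsMomentSolutionOn Set.univ h ν₂) {f : ℝ →ᵇ ℂ} (hf : Approx (ν₁ + ν₂) f) :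
    ∫ x, f x ∂ν₁ = ∫ x, f x ∂ν₂ := by
  have := h₁.isFiniteMeasure
  have := h₂.isFiniteMeasure
  set K : ENNReal := ν₁ Set.univ ^ (1 / 2 : ℝ) + ν₂ Set.univ ^ (1 / 2 : ℝ) with hK
  have hKtop : K ≠ ⊤ := by simp [hK]
  rw [← sub_eq_zero, ← enorm_eq_zero, ← nonpos_iff_eq_zero]
  refine ENNReal.le_of_forall_pos_le_add fun ε hε _ => ?_
  obtain ⟨p, hp⟩ := hf.2 (ε / (K + 1))
    (ENNReal.div_pos (by simpa using hε.ne') (by simp [hKtop])).ne'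
  have hm : Measurable fun x : ℝ => f x - p.eval (x : ℂ) := hf.1.sub (measurable_eval p)
  have e : ∀ ν : Measure ℝ, IsFiniteMeasure ν → IsMomentSolutionOn Set.univ h ν →
      ∫ x, f x ∂ν = (∫ x : ℝ, f x - p.eval (x : ℂ) ∂ν)
        + ∑ k ∈ Finset.range (p.natDegree + 1), p.coeff k * h k := fun ν hfin hν => by
    rw [integral_sub (f.integrable ν) (integrable_eval_complex hν p), integral_eval_complex hν p]
    ring
  have b₁ : ‖∫ x : ℝ, f x - p.eval (x : ℂ) ∂ν₁‖ₑ ≤ ε / (K + 1) * ν₁ Set.univ ^ (1 / 2 : ℝ) :=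
    (norm_integral_le_eLpNorm_two hm).trans (mul_le_mul_left
      ((eLpNorm_mono_measure _ (Measure.le_add_right le_rfl)).trans hp) _)
  have b₂ : ‖∫ x : ℝ, f x - p.eval (x : ℂ) ∂ν₂‖ₑ ≤ ε / (K + 1) * ν₂ Set.univ ^ (1 / 2 : ℝ) :=
    (norm_integral_le_eLpNorm_two hm).trans (mul_le_mul_left
      ((eLpNorm_mono_measure _ (Measure.le_add_left le_rfl)).trans hp) _)
  rw [e ν₁ inferInstance h₁, e ν₂ inferInstance h₂, add_sub_add_right_eq_sub, zero_add]
  calc _ ≤ ε / (K + 1) * ν₁ Set.univ ^ (1 / 2 : ℝ) + ε / (K + 1) * ν₂ Set.univ ^ (1 / 2 : ℝ) :=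
        enorm_sub_le.trans (add_le_add b₁ b₂)
    _ = ε / (K + 1) * K := by rw [← mul_add]
    _ ≤ ε / (K + 1) * (K + 1) := mul_le_mul_right le_self_add _
    _ = ε := ENNReal.div_mul_cancel (by simp) (by simp [hKtop])

/-- A real polynomial of modulus `1` at `i` gives an approximation of `1 / (x - i)`. -/
theorem eLpNorm_resolvent_sub {σ : Measure ℝ} {r : ℝ[X]} (hr : ‖aeval Complex.I r‖ = 1)
    (hint : Integrable (fun x => r.eval x ^ 2 / (1 + x ^ 2)) σ) :
    ∃ p : ℂ[X], eLpNorm (fun x : ℝ => resolvent x - p.eval (x : ℂ)) 2 σ ^ 2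
      = ENNReal.ofReal (∫ x, r.eval x ^ 2 / (1 + x ^ 2) ∂σ) := by
  set c := aeval Complex.I r with hc
  have hc0 : c ≠ 0 := fun h0 => by simp [h0] at hr
  let P := r.map (algebraMap ℝ ℂ)
  have hPI : P.eval Complex.I = c := by rw [hc, aeval_def, eval_map]
  have hPx : ∀ x : ℝ, P.eval (x : ℂ) = (r.eval x : ℝ) := fun x => by
    rw [eval_map_algebraMap]; simpa using aeval_algebraMap_apply ℂ x r
  -- With `r = c + (x - i) Q`, the error `1 / (x - i) + Q / c` equals `r / (c (x - i))`, and `|c| =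
  -- 1`.
  refine ⟨C (-c⁻¹) * (P /ₘ (X - C Complex.I)), ?_⟩
  have hpt : ∀ x : ℝ, resolvent x - (C (-c⁻¹) * (P /ₘ (X - C Complex.I))).eval (x : ℂ)
      = c⁻¹ * ((r.eval x : ℝ) * ((x : ℂ) - Complex.I)⁻¹) := fun x => by
    have h1 := congrArg (eval (x : ℂ)) (modByMonic_add_div P (X - C Complex.I))
    rw [modByMonic_X_sub_C_eq_C_eval, hPI] at h1
    simp only [eval_add, eval_mul, eval_sub, eval_X, eval_C, hPx] at h1
    simp only [eval_mul, eval_C, resolvent_apply]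
    rw [← h1]
    field_simp [ofReal_sub_I_ne_zero x]
    ring
  have hsq : ∀ x : ℝ, ‖resolvent x - (C (-c⁻¹) * (P /ₘ (X - C Complex.I))).eval (x : ℂ)‖ ^ 2
      = r.eval x ^ 2 / (1 + x ^ 2) := fun x => by
    rw [hpt, norm_mul, norm_inv, hr, inv_one, one_mul, norm_mul, mul_pow, norm_inv, inv_pow,
      sq_norm_ofReal_sub_I, Complex.norm_real, Real.norm_eq_abs, sq_abs, div_eq_mul_inv]
  rw [eLpNorm_eq_lintegral_rpow_enorm_toReal two_ne_zero ENNReal.ofNat_ne_top]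
  rw [ofReal_integral_eq_lintegral_ofReal hint (.of_forall fun x => by positivity)]
  rw [← ENNReal.rpow_natCast, ← ENNReal.rpow_mul]
  norm_num
  refine lintegral_congr fun x => ?_
  rw [← hsq, ENNReal.ofReal_pow (norm_nonneg _), ofReal_norm]
  simp

theorem integrable_eval_sq_div (hν : IsMomentSolutionOn Set.univ h ν) (r : ℝ[X]) :
    Integrable (fun x => r.eval x ^ 2 / (1 + x ^ 2)) ν := by
  refine Integrable.mono' (g := fun x => (r ^ 2).eval x) (hν.integrable_eval _) ?_ ?_
  · have hc : Continuous fun x : ℝ => r.eval x ^ 2 / (1 + x ^ 2) :=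
      (r.continuous.pow 2).div (by fun_prop) fun x => by positivity
    exact hc.aestronglyMeasurable
  · refine .of_forall fun x => ?_
    rw [Real.norm_eq_abs, abs_of_nonneg (by positivity), eval_pow]
    exact div_le_self (sq_nonneg _) (by nlinarith [sq_nonneg x])

/-- A criterion of Marcel Riesz type for the determinacy of the Hamburger moment problem. -/
theorem eq_of_exists_polynomial
    (H : ∀ ε > 0, ∃ r : ℝ[X], ‖aeval Complex.I r‖ = 1 ∧
      ∀ ν, IsMomentSolutionOn Set.univ h ν → ∫ x, r.eval x ^ 2 / (1 + x ^ 2) ∂ν ≤ ε)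
    (h₁ : IsMomentSolutionOn Set.univ h ν₁) (h₂ : IsMomentSolutionOn Set.univ h ν₂) :
    ν₁ = ν₂ := by
  have := h₁.isFiniteMeasure
  have := h₂.isFiniteMeasure
  have he : Approx (ν₁ + ν₂) resolvent := by
    refine ⟨resolvent.continuous.measurable, fun ε hε => ?_⟩
    rcases eq_or_ne ε ⊤ with rfl | htop
    · exact ⟨0, le_top⟩
    obtain ⟨r, hr, hr'⟩ := H (ε.toReal ^ 2 / 2)
      (half_pos (pow_pos (ENNReal.toReal_pos hε htop) 2))
    have i₁ := integrable_eval_sq_div h₁ r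
    have i₂ := integrable_eval_sq_div h₂ r
    obtain ⟨p, hp⟩ := eLpNorm_resolvent_sub hr (i₁.add_measure i₂)
    refine ⟨p, ?_⟩
    rw [← ENNReal.pow_le_pow_left_iff two_ne_zero, hp, integral_add_measure i₁ i₂]
    refine ENNReal.ofReal_le_of_le_toReal ?_
    rw [ENNReal.toReal_pow]
    linarith [hr' ν₁ h₁, hr' ν₂ h₂]
  refine ext_of_forall_mem_subalgebra_integral_eq_of_polish
    (separatesPoints_of_resolvent_mem (resolvent_mem_multiplierAlgebra he)) fun g hg => ?_
  refine Approx.integral_eq h₁ h₂ ?_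
  -- A multiplier lies in the closure itself: apply it to the constant `1`.
  simpa using hg.1 _ (approx_eval _ 1)

end PolynomialClosure

/-! ### Passage between the Stieltjes and Hamburger problems -/

/-- The symmetric measure on the line whose image under squaring is a given measure on `[0, ∞)`. -/
noncomputable def symmetrization (μ : Measure ℝ) : Measure ℝ :=
  (2⁻¹ : ENNReal) • (μ.map Real.sqrt + μ.map fun x => -√x)

/-- This makes symmetrization injective on measures carried by `[0, ∞)`, which is what the easy
implication uses. -/
theorem map_sq_symmetrization {μ : Measure ℝ} (hμ : ∀ᵐ x ∂μ, 0 ≤ x) :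
    (symmetrization μ).map (fun x => x ^ 2) = μ := by
  have h₁ : Measurable fun x : ℝ => x ^ 2 := by fun_prop
  have h₂ : Measurable fun x : ℝ => -√x := by fun_prop
  have hid : μ.map (fun x => √x ^ 2) = μ := by
    conv_rhs => rw [← Measure.map_id (μ := μ)]
    exact Measure.map_congr (hμ.mono fun x hx => Real.sq_sqrt hx)
  rw [symmetrization, Measure.map_smul, Measure.map_add _ _ h₁,
    Measure.map_map h₁ Real.continuous_sqrt.measurable, Measure.map_map h₁ h₂]
  simp only [Function.comp_def, neg_sq, hid]
  rw [← two_smul ENNReal μ, smul_smul, ENNReal.inv_mul_cancel two_ne_zero ENNReal.ofNat_ne_top,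
    one_smul]

theorem IsMomentSolutionOn.mono {I J : Set ℝ} {s : ℕ → ℝ} {μ : Measure ℝ}
    (h : IsMomentSolutionOn I s μ) (hIJ : I ⊆ J) : IsMomentSolutionOn J s μ :=
  ⟨h.support_subset.trans hIJ, h.integrable_pow, h.moment_eq⟩

/-- The symmetrization of a Stieltjes solution is a Hamburger solution. -/
theorem IsMomentSolutionOn.symmetrization {s : ℕ → ℝ} {μ : Measure ℝ}
    (h : IsMomentSolutionOn (Set.Ici 0) s μ) :
    IsMomentSolutionOn Set.univ (interlaceZero s) (symmetrization μ) := by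
  have hm₁ : Measurable Real.sqrt := Real.continuous_sqrt.measurable
  have hm₂ : Measurable fun x : ℝ => -√x := by fun_prop
  have hint : ∀ k : ℕ, Integrable (fun x => √x ^ k) μ := fun k => by
    refine Integrable.mono' (g := fun x => x ^ 0 + x ^ k)
      ((h.integrable_pow 0).add (h.integrable_pow k)) (by fun_prop) ?_
    filter_upwards [h.ae_mem] with x hx
    have h1 : √x ^ k * √x ^ k = x ^ k := by rw [← mul_pow, Real.mul_self_sqrt hx]
    rw [Real.norm_eq_abs, abs_of_nonneg (by positivity), ← h1, pow_zero]
    -- This is `t ≤ 1 + t²` for `t = √x ^ k`.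
    nlinarith [sq_nonneg (√x ^ k - 1)]
  have hint' : ∀ k : ℕ, Integrable (fun x => (-√x) ^ k) μ := fun k => by
    simp only [neg_pow (√_) k]
    exact (hint k).const_mul _
  have i₁ : ∀ k : ℕ, Integrable (fun x => x ^ k) (μ.map Real.sqrt) := fun k =>
    (integrable_map_measure (by fun_prop) hm₁.aemeasurable).2 (hint k)
  have i₂ : ∀ k : ℕ, Integrable (fun x => x ^ k) (μ.map fun x => -√x) := fun k =>
    (integrable_map_measure (by fun_prop) hm₂.aemeasurable).2 (hint' k)
  refine ⟨Set.subset_univ _, fun k =>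
    ((i₁ k).add_measure (i₂ k)).smul_measure (by simp), fun k => ?_⟩
  rw [_root_.symmetrization, integral_smul_measure, integral_add_measure (i₁ k) (i₂ k),
    integral_map hm₁.aemeasurable (by fun_prop), integral_map hm₂.aemeasurable (by fun_prop),
    interlaceZero]
  simp only [neg_pow (√_) k, integral_const_mul]
  split_ifs with hk
  · obtain ⟨m, rfl⟩ := hk
    have : ∫ x, √x ^ (m + m) ∂μ = s m := by
      rw [← h.moment_eq m]
      refine integral_congr_ae ?_
      filter_upwards [h.ae_mem] with x hx
      rw [pow_add, ← mul_pow, Real.mul_self_sqrt hx]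
    rw [this, Even.neg_one_pow ⟨m, rfl⟩, ← two_mul m, Nat.mul_div_cancel_left m two_pos]
    simp
    ring
  · rw [(Nat.not_even_iff_odd.1 hk).neg_one_pow]
    simp

/-- The image under squaring of a Hamburger solution is a Stieltjes solution. -/
theorem IsMomentSolutionOn.map_sq {s : ℕ → ℝ} {ν : Measure ℝ}
    (h : IsMomentSolutionOn Set.univ (interlaceZero s) ν) :
    IsMomentSolutionOn (Set.Ici 0) s (ν.map fun x => x ^ 2) := by
  have hm : Measurable fun x : ℝ => x ^ 2 := by fun_prop
  refine ⟨?_, fun k => ?_, fun k => ?_⟩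
  · refine Measure.support_subset_of_isClosed isClosed_Ici ?_
    exact (ae_map_iff hm.aemeasurable measurableSet_Ici).2 (.of_forall fun x => sq_nonneg x)
  · refine (integrable_map_measure (by fun_prop) hm.aemeasurable).2 ?_
    simpa [Function.comp_def, ← pow_mul] using h.integrable_pow (2 * k)
  · rw [integral_map hm.aemeasurable (by fun_prop)]
    simpa [← pow_mul, interlaceZero] using h.moment_eq (2 * k)

open Polynomial in
-- For `r = x b(x²)` one has `r(i) = i b(-1)`, and `r² / (1 + x²)` is `y b(y)² / (1 + y)` at `y =
-- x²`. By uniqueness every `ν` has image `μ` under squaring, so one `r` serves all `ν`.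
theorem IsMomentSolutionOn.exists_polynomial_of_unique_Ici_zero {s : ℕ → ℝ} {μ : Measure ℝ}
    (h : IsMomentSolutionOn (Set.Ici 0) s μ)
    (huniq : ∀ μ', IsMomentSolutionOn (Set.Ici 0) s μ' → μ' = μ) {ε : ℝ} (hε : 0 < ε) :
    ∃ r : ℝ[X], ‖aeval Complex.I r‖ = 1 ∧
      ∀ ν, IsMomentSolutionOn Set.univ (interlaceZero s) ν →
        ∫ x, r.eval x ^ 2 / (1 + x ^ 2) ∂ν ≤ ε := by
  obtain ⟨b, hb, hb'⟩ := h.exists_polynomial_eval_neg_one le_rfl huniq hε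
  refine ⟨X * b.comp (X ^ 2), ?_, fun ν hν => ?_⟩
  · have : aeval (-1 : ℂ) b = 1 := by
      have := aeval_algebraMap_apply ℂ (-1 : ℝ) b
      simpa [hb] using this
    simp [aeval_comp, this]
  · rw [← huniq _ hν.map_sq, integral_map (by fun_prop)] at hb'
    · refine le_of_eq_of_le (integral_congr_ae (.of_forall fun x => ?_)) hb'
      simp [mul_pow]
    · have : Measurable fun y => b.eval y := b.continuous.measurable
      exact Measurable.aestronglyMeasurable (by fun_prop)

open Polynomial in
-- The image of `ν` under squaring is only known to live on `[0, ∞)`, where uniqueness is not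
-- assumed. The weight is therefore removed first: `∫ b² dμ` depends on the moments alone and so is
-- the same for that image. The gap between `δ` and `2δ` keeps the weight away from `0` on the
-- support of `μ`.
theorem IsMomentSolutionOn.exists_polynomial_of_unique_Ici_pos {δ : ℝ} (hδ : 0 < δ) {s : ℕ → ℝ}
    {μ : Measure ℝ}
    (h : IsMomentSolutionOn (Set.Ici (2 * δ)) s μ)
    (huniq : ∀ μ', IsMomentSolutionOn (Set.Ici δ) s μ' → μ' = μ) {ε : ℝ} (hε : 0 < ε) :
    ∃ r : ℝ[X], ‖aeval Complex.I r‖ = 1 ∧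
      ∀ ν, IsMomentSolutionOn Set.univ (interlaceZero s) ν →
        ∫ x, r.eval x ^ 2 / (1 + x ^ 2) ∂ν ≤ ε := by
  -- The minimum of `(y - δ) / (1 + y)` on `[2δ, ∞)`, attained at `2δ`.
  have hκ : 0 < δ / (1 + 2 * δ) := by positivity
  have hδI : IsMomentSolutionOn (Set.Ici δ) s μ := h.mono (Set.Ici_subset_Ici.2 (by linarith))
  obtain ⟨b, hb, hb'⟩ := hδI.exists_polynomial_eval_neg_one hδ.le huniq (mul_pos hκ hε)
  have hbμ : ∫ y, (b ^ 2).eval y ∂μ ≤ ε := by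
    refine le_of_mul_le_mul_left ?_ hκ
    rw [← integral_const_mul]
    refine (integral_mono_of_nonneg (.of_forall fun y => ?_) ?_ ?_).trans hb'
    · simp only [eval_pow, Pi.zero_apply]; positivity
    · have hm : Measurable fun y => b.eval y := b.continuous.measurable
      refine Integrable.mono' (g := fun y => ((X + 1) * b ^ 2).eval y) (h.integrable_eval _)
        (Measurable.aestronglyMeasurable (by fun_prop)) ?_
      filter_upwards [h.ae_mem] with y hy
      have hy' : 2 * δ ≤ y := hy
      have h1 : 0 < 1 + y := by linarith
      have h2 : 0 ≤ (y - δ) * b.eval y ^ 2 := mul_nonneg (by linarith) (sq_nonneg _)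
      rw [Real.norm_eq_abs, abs_of_nonneg (div_nonneg h2 h1.le)]
      refine (div_le_self h2 (by linarith)).trans ?_
      simp only [eval_mul, eval_add, eval_X, eval_one, eval_pow]
      exact mul_le_mul_of_nonneg_right (by linarith) (sq_nonneg _)
    · filter_upwards [h.ae_mem] with y hy
      have hy' : 2 * δ ≤ y := hy
      have h1 : 0 < 1 + y := by linarith
      rw [eval_pow, mul_div_right_comm]
      refine mul_le_mul_of_nonneg_right ?_ (sq_nonneg _)
      rw [div_le_div_iff₀ (by linarith) h1]
      nlinarith
  refine ⟨b.comp (X ^ 2), ?_, fun ν hν => ?_⟩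
  · have : aeval (-1 : ℂ) b = 1 := by
      have := aeval_algebraMap_apply ℂ (-1 : ℝ) b
      simpa [hb] using this
    simp [aeval_comp, this]
  · refine le_trans ?_ hbμ
    rw [h.integral_eval, ← hν.map_sq.integral_eval, integral_map (by fun_prop)
      (b ^ 2).continuous.aestronglyMeasurable]
    refine integral_mono_of_nonneg (.of_forall fun x => by positivity) ?_ (.of_forall fun x => ?_)
    · have := hν.integrable_eval ((b ^ 2).comp (X ^ 2))
      simpa using this
    · simp only [eval_comp, eval_pow, eval_X]
      exact div_le_self (sq_nonneg _) (by nlinarith [sq_nonneg x])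

/-- A solution on the open half-line is carried by a closed half-line inside it. -/
theorem IsMomentSolutionOn.exists_pos_Ici {s : ℕ → ℝ} {μ : Measure ℝ}
    (h : IsMomentSolutionOn (Set.Ioi 0) s μ) :
    ∃ δ > 0, IsMomentSolutionOn (Set.Ici (2 * δ)) s μ := by
  have h0 : (0 : ℝ) ∈ μ.supportᶜ := fun h0 => lt_irrefl (0 : ℝ) (h.support_subset h0)
  obtain ⟨ε, hε, hball⟩ := Metric.isOpen_iff.1 Measure.isOpen_compl_support 0 h0
  refine ⟨ε / 2, half_pos hε, fun x hx => ?_, h.integrable_pow, h.moment_eq⟩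
  have hx0 : 0 < x := h.support_subset hx
  by_contra hlt
  rw [Set.mem_Ici, not_le] at hlt
  refine hball ?_ hx
  rw [Metric.mem_ball, Real.dist_eq, sub_zero, abs_of_pos hx0]
  linarith

/-- The Stieltjes problem is the moment problem on a half-line `I`; the claim is made both for the
closed half-line `[0, ∞)` and for the open half-line `(0, ∞)`. -/
theorem mainTheorem5 (I : Set ℝ) (hI : I = Set.Ici 0 ∨ I = Set.Ioi 0)
    (s : ℕ → ℝ) (hs : IsMomentSequenceOn I s) :
    IsHamburgerMomentSequence (interlaceZero s) ∧
      (IsHamburgerDeterminate (interlaceZero s) ↔ IsDeterminateOn I s) := by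
  have hI0 : I ⊆ Set.Ici 0 := by
    rcases hI with rfl | rfl
    exacts [subset_rfl, Set.Ioi_subset_Ici_self]
  obtain ⟨μ, hμ⟩ := hs
  have hsol := (hμ.mono hI0).symmetrization
  refine ⟨⟨_, hsol⟩, fun hdet => ⟨μ, hμ, fun μ' hμ' => ?_⟩, fun hdet => ⟨_, hsol, fun ν hν => ?_⟩⟩
  · rw [← map_sq_symmetrization (hμ'.mono hI0).ae_mem,
      ← map_sq_symmetrization (hμ.mono hI0).ae_mem,
      hdet.unique (hμ'.mono hI0).symmetrization hsol]
  · refine PolynomialClosure.eq_of_exists_polynomial (fun ε hε => ?_) hν hsol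
    rcases hI with rfl | rfl
    · exact hμ.exists_polynomial_of_unique_Ici_zero (fun μ' hμ' => hdet.unique hμ' hμ) hε
    · obtain ⟨δ, hδ, hμδ⟩ := hμ.exists_pos_Ici
      exact hμδ.exists_polynomial_of_unique_Ici_pos hδ (fun μ' hμ' => hdet.unique
        (hμ'.mono fun x hx => lt_of_lt_of_le hδ hx) hμ) hε
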